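/- All logarithms without a base are binary. For words $v,w$ over a finite alphabet let $|w|_v$ be the number of (possibly overlapping) occurrences of $v$ in $w$, with $|w|_\epsilon=|w|$, and let $$H_k(w)=-\frac1{|w|}\sum_{|v|=k,\ a\text{ a letter}}|w|_{va}\log\frac{|w|_{va}}{|w|_v}$$ be the $k$-order empirical entropy (a summand with $|w|_{va}=0$ is $0$). A full grammar $(S',G)$ consists of a starting string $S'$ and of exactly one rule $X\to \mathrm{rhs}(X)$ for each nonterminal $X$ of $G$, without circular dependencies; $\exp(X)$ is the string of letters generated by $X$, and $(S',G)$ generates $S$ if $S'$ expands to $S$. Let $S_G$ be the concatenation of $S'$ and of all right-hand sides of $G$. The full grammar is irreducible if * (IG1) no two nonterminals have the same expansion; * (IG2) every nonterminal except the start symbol occurs at least twice in $S_G$; * (IG3) no pair of symbols has two non-overlapping occurrences in the right-hand sides ($S'$ and the right-hand sides of $G$; each occurrence lies within one of them). The size in bits of the entropy coding of $(S',G)$ is $|S_G|H_0(S_G)$ plus the cost of storing in unary the lengths of all right-hand sides ($\ell+1$ bits for a length $\ell$). **Theorem.** Let $\sigma=\sigma(n)\ge 2$ and $k=k(n)\ge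 0$ be integers with $k=o(\log_\sigma n)$ as $n\to\infty$. Then there is a function $g$ with $g(n)=o(n\log\sigma)$ such that, for every string $S$ of length $n$ over an alphabet of size $\sigma$ and for every irreducible full grammar $(S',G)$ generating $S$, the size of the entropy coding of $(S',G)$ is at most $$2|S|H_k(S)+g(n)=2|S|H_k(S)+o(|S|\log\sigma).$$ If $\sigma\le n$, the same bound holds when $S_G$ is coded by an optimal (Huffman) binary prefix code and the frequencies of all symbols (letters and nonterminals) are stored in unary as the code table, in addition to the lengths of the right-hand sides. Moreover $|S_G|=O(n/\log_\sigma n)$ for $n\ge2$, with a constant that does not depend on $S$ and $(S',G)$. -/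

import Mathlib

open Filter Asymptotics

namespace GrammarCompression

/-! ### Strings and empirical entropy -/

/-- The number of (possibly overlapping) occurrences of `v` in `w`. The positions range over
`0, …, |w| - 1`, so for the empty word this number is `|w|`. -/
def occ {α : Type*} [DecidableEq α] (v w : List α) : ℕ :=
  ((Finset.range w.length).filter (fun i => v <+: w.drop i)).card

theorem occ_nil {α : Type*} [DecidableEq α] (w : List α) : occ [] w = w.length := by
  simp [occ]

/-- The `k`-order empirical entropy (in bits)
`H_k(w) = - (1 / |w|) ∑_{v ∈ α^k, a ∈ α} |w|_{va} log₂ (|w|_{va} / |w|_v)`.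
A summand with `|w|_{va} = 0` is `0`. -/
noncomputable def entropy {α : Type*} [Fintype α] [DecidableEq α] (k : ℕ) (w : List α) : ℝ :=
  -(1 / (w.length : ℝ)) * ∑ v : Fin k → α, ∑ a : α,
    (occ (List.ofFn v ++ [a]) w : ℝ) *
      Real.logb 2 ((occ (List.ofFn v ++ [a]) w : ℝ) / (occ (List.ofFn v) w : ℝ))

/-! ### Full grammars -/

/-- A full grammar `(S', G)` over the terminal alphabet `Γ`: a starting string and exactly one
rule for each of the `numNT` nonterminals of `G`. Symbols are letters (`Sum.inl`) or
nonterminals (`Sum.inr`). The nonterminals are listed in an order in which the right-hand side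
of a rule uses earlier nonterminals only; such an order exists exactly when the rules are not
circular, that is, when every nonterminal generates a unique string. -/
structure FullGrammar (Γ : Type*) where
  numNT : ℕ
  start : List (Γ ⊕ Fin numNT)
  rule : Fin numNT → List (Γ ⊕ Fin numNT)
  acyclic : ∀ X Y : Fin numNT, Sum.inr Y ∈ rule X → Y < X

namespace FullGrammar

variable {Γ : Type*}

/-- The expansion of a nonterminal: the string of letters that it generates. -/
def expand (G : FullGrammar Γ) (X : Fin G.numNT) : List Γ :=
  (G.rule X).attach.flatMap fun s =>
    match s with
    | ⟨Sum.inl a, _⟩ => [a]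
    | ⟨Sum.inr Y, _⟩ => G.expand Y
termination_by X.val
decreasing_by
  rename_i h
  exact G.acyclic X Y h

/-- The expansion of a symbol; a letter expands to itself. -/
def expandSymbol (G : FullGrammar Γ) : Γ ⊕ Fin G.numNT → List Γ
  | Sum.inl a => [a]
  | Sum.inr X => G.expand X

theorem expand_eq (G : FullGrammar Γ) (X : Fin G.numNT) :
    G.expand X = (G.rule X).flatMap G.expandSymbol := by
  rw [expand]
  conv_rhs => rw [← List.attach_map_subtype_val (G.rule X), List.flatMap_map]
  congr 1
  funext s
  rcases s with ⟨a | Y, h⟩ <;> rfl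

/-- The full grammar generates the string `S`. -/
def Generates (G : FullGrammar Γ) (S : List Γ) : Prop :=
  G.start.flatMap G.expandSymbol = S

/-- The right-hand sides: `none` stands for the start symbol, whose right-hand side is the
starting string. -/
def side (G : FullGrammar Γ) : Option (Fin G.numNT) → List (Γ ⊕ Fin G.numNT)
  | none => G.start
  | some X => G.rule X

/-- The concatenation of the starting string and of the right-hand sides of all rules. -/
def concat (G : FullGrammar Γ) : List (Γ ⊕ Fin G.numNT) :=
  G.start ++ (List.finRange G.numNT).flatMap G.rule

/-- The pair `A B` occurs at position `i` of the right-hand side `r`. -/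
def PairAt (G : FullGrammar Γ) (A B : Γ ⊕ Fin G.numNT) (r : Option (Fin G.numNT)) (i : ℕ) :
    Prop :=
  [A, B] <+: (G.side r).drop i

/-- Irreducible full grammars: (1) distinct nonterminals have distinct expansions; (2) every
nonterminal other than the start symbol occurs at least twice in the right-hand sides; (3) no
pair of symbols has two non-overlapping occurrences in the right-hand sides: any two of its
occurrences lie in the same right-hand side, at positions that differ by at most one. -/
structure Irreducible [DecidableEq Γ] (G : FullGrammar Γ) : Prop where
  expand_injective : Function.Injective G.expand
  two_le_count : ∀ X : Fin G.numNT, 2 ≤ G.concat.count (Sum.inr X)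
  pair_unique : ∀ (A B : Γ ⊕ Fin G.numNT) (r r' : Option (Fin G.numNT)) (i j : ℕ),
    G.PairAt A B r i → G.PairAt A B r' j → r = r' ∧ i ≤ j + 1 ∧ j ≤ i + 1

/-- The bits spent on the lengths of the right-hand sides, each stored in unary
(`|r|` ones followed by a zero), that of the starting string included. -/
def lengthBits (G : FullGrammar Γ) : ℕ :=
  ∑ r : Option (Fin G.numNT), ((G.side r).length + 1)

/-- The size in bits of the entropy coding of a full grammar: its concatenated right-hand sides
`S_G` are entropy coded, in `|S_G| H_0(S_G)` bits, and the lengths of the right-hand sides are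
stored. -/
noncomputable def entropyCodingSize [Fintype Γ] [DecidableEq Γ] (G : FullGrammar Γ) : ℝ :=
  (G.concat.length : ℝ) * entropy 0 G.concat + (G.lengthBits : ℝ)

end FullGrammar

/-! ### Coding with an optimal prefix code -/

/-- `c` is a binary prefix code for the symbols that occur in `w`. -/
def IsPrefixCode {α : Type*} (c : α → List Bool) (w : List α) : Prop :=
  ∀ a ∈ w, ∀ b ∈ w, a ≠ b → ¬ c a <+: c b

/-- The number of bits of `w` when each symbol is replaced by its code word. -/
def codedLength {α : Type*} (c : α → List Bool) (w : List α) : ℕ :=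
  (w.map fun a => (c a).length).sum

/-- `c` is an optimal prefix code for `w`, for instance a Huffman code. -/
def IsOptimalPrefixCode {α : Type*} (c : α → List Bool) (w : List α) : Prop :=
  IsPrefixCode c w ∧ ∀ c' : α → List Bool, IsPrefixCode c' w → codedLength c w ≤ codedLength c' w

/-- The size in bits of the Huffman variant of the entropy coding, for a prefix code `c`: the
coded right-hand sides; the table, which stores in unary the frequency of every symbol; and
the lengths of the right-hand sides. -/
def FullGrammar.prefixCodingSize {Γ : Type*} [Fintype Γ] [DecidableEq Γ] (G : FullGrammar Γ)
    (c : Γ ⊕ Fin G.numNT → List Bool) : ℕ :=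
  codedLength c G.concat + ∑ s : Γ ⊕ Fin G.numNT, (G.concat.count s + 1) + G.lengthBits

end GrammarCompression

namespace GrammarCompression

/-! ### Zero-order entropy and prefix codes -/

/-! By Gibbs' inequality `length_mul_entropy_zero_le`, |S_G| H_0(S_G) is at most the total code
length -log q over S_G for any subprobability q on the symbols, and an optimal prefix code loses at
most one further bit per symbol. So it suffices to exhibit a good q.

The chosen q (`symbolProb`) generates the expansion of a symbol letter by letter, the first k
letters uniformly and the others by the empirical k-order model of S, and stops after each letter
with probability 1 - p. Distinct nonterminals have distinct expansions (IG1), so the total weight is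
at most 1. A symbol costs O(1) + log 1/(1 - p) + k log σ bits, plus -log p per letter of its
expansion, plus the model cost of its expansion.

The factor 2 comes from `Irreducible.sum_map_concat_le`: both length and model cost are nonnegative
and superadditive, and every nonterminal occurs at least twice (IG2), so their sums over S_G are at
most twice their values at S. For the model cost this value is |S| H_k(S).

It remains to bound |S_G|. By IG3 the disjoint adjacent pairs are all distinct; few pairs consist of
two short expansions, and the others are few because the expansions have total length at most 2|S|.
Hence |S_G| = O(n / log_σ n), and with p = λ/(λ + 1), λ = log_σ n, all overheads are o(n log σ). -/

theorem occ_singleton {α : Type*} [DecidableEq α] (a : α) (w : List α) :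
    occ [a] w = w.count a := by
  induction w with
  | nil => simp [occ]
  | cons b w ih =>
    have h : occ [a] (b :: w) = (if a = b then 1 else 0) + occ [a] w := by
      simp only [occ, List.length_cons, Finset.card_filter]
      rw [Finset.sum_range_succ']
      simp [add_comm]
    rw [h, ih, List.count_cons]
    by_cases hab : a = b
    · simp [hab, add_comm]
    · simp [hab, Ne.symm hab]

instance {α β : Type*} [BEq α] [BEq β] [LawfulBEq α] [LawfulBEq β] : LawfulBEq (α ⊕ β) where
  eq_of_beq {a b} h := by
    cases a <;> cases b
    · exact congrArg Sum.inl (eq_of_beq h)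
    · exact absurd h Bool.false_ne_true
    · exact absurd h Bool.false_ne_true
    · exact congrArg Sum.inr (eq_of_beq h)
  rfl {a} := by
    cases a with
    | inl a => exact beq_self_eq_true a
    | inr b => exact beq_self_eq_true b

theorem sum_count_mul_eq_sum_map {α : Type*} [Fintype α] [BEq α] [LawfulBEq α] (w : List α)
    (f : α → ℝ) : ∑ a, (w.count a : ℝ) * f a = (w.map f).sum := by
  classical
  induction w with
  | nil => simp
  | cons b w ih =>
    simp only [List.count_cons, List.map_cons, List.sum_cons, ← ih, Nat.cast_add, add_mul,
      Finset.sum_add_distrib, beq_iff_eq]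
    simp [add_comm]

theorem sum_count_eq_length {α : Type*} [Fintype α] [BEq α] [LawfulBEq α] (w : List α) :
    ∑ a, w.count a = w.length := by
  have h := sum_count_mul_eq_sum_map w fun _ => (1 : ℝ)
  simp only [mul_one, List.map_const', List.sum_replicate, nsmul_eq_mul] at h
  exact_mod_cast h

/-- Gibbs' inequality for the empirical distribution of a word. -/
theorem length_mul_entropy_zero_le {α : Type*} [Fintype α] [DecidableEq α] (w : List α)
    (q : α → ℝ) (hq : ∀ a ∈ w, 0 < q a) (hnn : ∀ a, 0 ≤ q a) (hsum : ∑ a, q a ≤ 1) :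
    (w.length : ℝ) * entropy 0 w ≤ (w.map fun a => -Real.logb 2 (q a)).sum := by
  rcases eq_or_ne w [] with rfl | hw
  · simp
  have hm : (0 : ℝ) < w.length := by exact_mod_cast List.length_pos_iff.2 hw
  have hl2 : 0 < Real.log 2 := Real.log_pos one_lt_two
  have hent : (w.length : ℝ) * entropy 0 w =
      ∑ a, (w.count a : ℝ) * -Real.logb 2 ((w.count a : ℝ) / w.length) := by
    simp only [entropy, Finset.univ_unique, List.ofFn_zero, List.nil_append, occ_singleton,
      occ_nil, Finset.sum_const, Finset.card_singleton, one_smul, mul_neg, Finset.sum_neg_distrib]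
    field_simp
  rw [hent, ← sum_count_mul_eq_sum_map, ← sub_nonpos, ← Finset.sum_sub_distrib]
  -- This is `log x ≤ x - 1` at x = q a · |w| / count a, multiplied by the count; the right-hand
  -- sides sum to at most 0.
  have key : ∀ a, (w.count a : ℝ) * -Real.logb 2 ((w.count a : ℝ) / w.length) -
      (w.count a : ℝ) * -Real.logb 2 (q a) ≤ (q a * w.length - w.count a) / Real.log 2 := by
    intro a
    by_cases ha : a ∈ w
    · have hc : (0 : ℝ) < w.count a := by exact_mod_cast List.count_pos_iff.2 ha
      have hqa := hq a ha
      have h1 := Real.log_le_sub_one_of_pos (x := q a * w.length / w.count a) (by positivity)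
      rw [Real.log_div (by positivity) (by positivity), Real.log_mul hqa.ne' hm.ne'] at h1
      rw [Real.logb, Real.logb, Real.log_div hc.ne' hm.ne', le_div_iff₀ hl2]
      have h2 := mul_le_mul_of_nonneg_left h1 hc.le
      have h3 : (w.count a : ℝ) * (q a * w.length / w.count a - 1) =
          q a * w.length - w.count a := by field_simp
      rw [h3] at h2
      refine le_trans (le_of_eq ?_) h2
      field_simp
      ring
    · have : w.count a = 0 := List.count_eq_zero.2 ha
      have := hnn a
      simp only [*, Nat.cast_zero, zero_mul, sub_zero]
      positivity
  refine (Finset.sum_le_sum fun a _ => key a).trans ?_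
  rw [← Finset.sum_div]
  apply div_nonpos_of_nonpos_of_nonneg _ hl2.le
  rw [Finset.sum_sub_distrib, ← Finset.sum_mul]
  have h4 : ∑ a, (w.count a : ℝ) = w.length := by exact_mod_cast sum_count_eq_length w
  rw [h4]
  nlinarith

/-- The converse of Kraft's inequality. -/
theorem exists_prefixFree_of_kraft {α : Type*} [DecidableEq α] (l : α → ℕ) (A : Finset α)
    (h : ∑ a ∈ A, (1 / 2 : ℝ) ^ l a ≤ 1) :
    ∃ c : α → List Bool, (∀ a ∈ A, (c a).length = l a) ∧
      ∀ a ∈ A, ∀ b ∈ A, a ≠ b → ¬ c a <+: c b := by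
  induction A using Finset.induction_on_max_value l with
  | empty => exact ⟨fun _ => [], by simp, by simp⟩
  | insert a A ha hmax ih =>
    rw [Finset.sum_insert ha] at h
    have hpos : (0 : ℝ) < (1 / 2 : ℝ) ^ l a := by positivity
    obtain ⟨c, hlen, hpre⟩ := ih (by linarith)
    -- Code words are assigned by increasing length. An earlier word `c b` rules out its 2 ^ (l a -
    -- l b) extensions of length `l a`; by the Kraft sum these do not exhaust the 2 ^ l a
    -- candidates.
    let bad : α → Finset (List.Vector Bool (l a)) := fun b =>
      Finset.univ.filter fun w => c b <+: w.1
    have hbad : ∀ b ∈ A, (bad b).card ≤ 2 ^ (l a - l b) := by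
      intro b hb
      rw [← Fintype.card_bool, ← card_vector, ← Finset.card_univ]
      have hle := hmax b hb
      refine Finset.card_le_card_of_injOn
        (fun w => ⟨w.1.drop (l b), by rw [List.length_drop, w.2]⟩)
        (fun _ _ => Finset.mem_coe.2 (Finset.mem_univ _)) ?_
      intro w hw w' hw' heq
      simp only [bad, Finset.coe_filter, Finset.mem_univ, true_and, Set.mem_ofPred_eq] at hw hw'
      obtain ⟨t, ht⟩ := hw
      obtain ⟨t', ht'⟩ := hw'
      have h1 : w.1.drop (l b) = w'.1.drop (l b) := congrArg Subtype.val heq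
      rw [← ht, ← ht', ← hlen b hb, List.drop_left, List.drop_left] at h1
      exact Subtype.ext (by rw [← ht, ← ht', h1])
    have hcard : (A.biUnion bad).card < Fintype.card (List.Vector Bool (l a)) := by
      refine (Finset.card_biUnion_le.trans (Finset.sum_le_sum hbad)).trans_lt ?_
      rw [card_vector, Fintype.card_bool]
      have h1 : ((∑ b ∈ A, 2 ^ (l a - l b) : ℕ) : ℝ) =
          2 ^ l a * ∑ b ∈ A, (1 / 2 : ℝ) ^ l b := by
        rw [Finset.mul_sum]
        push_cast
        refine Finset.sum_congr rfl fun b hb => ?_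
        rw [pow_sub₀ _ two_ne_zero (hmax b hb), one_div, inv_pow]
      have h2 : ((∑ b ∈ A, 2 ^ (l a - l b) : ℕ) : ℝ) < 2 ^ l a := by
        rw [h1]
        have : (0 : ℝ) < 2 ^ l a := by positivity
        nlinarith
      exact_mod_cast h2
    obtain ⟨w, hw⟩ : ∃ w, w ∉ A.biUnion bad := by
      by_contra! hall
      exact hcard.not_ge (by rw [Finset.eq_univ_of_forall hall, Finset.card_univ])
    have hw' : ∀ b ∈ A, ¬ c b <+: w.1 := by
      intro b hb hp
      exact hw (Finset.mem_biUnion.2 ⟨b, hb, by simpa [bad] using hp⟩)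
    have hne : ∀ b ∈ A, b ≠ a := fun b hb hba => ha (hba ▸ hb)
    refine ⟨Function.update c a w.1, ?_, ?_⟩
    · intro b hb
      rcases Finset.mem_insert.1 hb with rfl | hb
      · simp [w.2]
      · rw [Function.update_of_ne (hne b hb), hlen b hb]
    · intro b hb b' hb' hbb'
      rcases Finset.mem_insert.1 hb with rfl | hb₁ <;>
        rcases Finset.mem_insert.1 hb' with rfl | hb₂
      · exact absurd rfl hbb'
      · rw [Function.update_self, Function.update_of_ne (hne b' hb₂)]
        intro hp
        have h1 := hp.length_le
        rw [w.2, hlen b' hb₂] at h1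
        have h2 : w.1 = c b' := hp.eq_of_length (by
          rw [w.2, hlen b' hb₂]; exact le_antisymm h1 (hmax b' hb₂))
        exact hw' b' hb₂ (h2 ▸ List.prefix_refl _)
      · rw [Function.update_self, Function.update_of_ne (hne b hb₁)]
        exact hw' b hb₁
      · rw [Function.update_of_ne (hne b hb₁), Function.update_of_ne (hne b' hb₂)]
        exact hpre b hb₁ b' hb₂ hbb'

/-- An optimal prefix code is at most one bit per symbol worse than the code lengths
`-log₂ q` of a subprobability distribution `q`. -/
theorem IsOptimalPrefixCode.codedLength_le {α : Type*} [Fintype α] [DecidableEq α] {w : List α}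
    {c : α → List Bool} (hc : IsOptimalPrefixCode c w)
    (q : α → ℝ) (hq : ∀ a ∈ w, 0 < q a) (hnn : ∀ a, 0 ≤ q a) (hsum : ∑ a, q a ≤ 1) :
    (codedLength c w : ℝ) ≤ (w.map fun a => -Real.logb 2 (q a)).sum + w.length := by
  have hle1 : ∀ a, q a ≤ 1 := fun a =>
    (Finset.single_le_sum (fun b _ => hnn b) (Finset.mem_univ a)).trans hsum
  -- Shannon's code lengths; rounding up costs the extra bit per symbol.
  let l : α → ℕ := fun a => ⌈-Real.logb 2 (q a)⌉₊
  have hl : ∀ a ∈ w.toFinset, (1 / 2 : ℝ) ^ l a ≤ q a := by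
    intro a ha
    have hqa := hq a (List.mem_toFinset.1 ha)
    have h1 : -Real.logb 2 (q a) ≤ l a := Nat.le_ceil _
    rw [one_div, inv_pow, ← Real.rpow_natCast, ← Real.rpow_neg zero_le_two]
    calc (2 : ℝ) ^ (-(l a : ℝ)) ≤ 2 ^ Real.logb 2 (q a) :=
          Real.rpow_le_rpow_of_exponent_le one_le_two (by linarith)
      _ = q a := Real.rpow_logb two_pos (by norm_num) hqa
  obtain ⟨c', hlen, hpre⟩ := exists_prefixFree_of_kraft l w.toFinset
    ((Finset.sum_le_sum hl).trans ((Finset.sum_le_univ_sum_of_nonneg hnn).trans hsum))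
  have h1 := hc.2 c' fun a ha b hb => hpre a (List.mem_toFinset.2 ha) b (List.mem_toFinset.2 hb)
  have h2 : (codedLength c' w : ℝ) ≤ (w.map fun a => -Real.logb 2 (q a) + 1).sum := by
    rw [codedLength, Nat.cast_list_sum, List.map_map]
    refine List.sum_le_sum fun a ha => ?_
    simp only [Function.comp, hlen a (List.mem_toFinset.2 ha)]
    refine (Nat.ceil_lt_add_one ?_).le
    rw [neg_nonneg]
    exact Real.logb_nonpos one_lt_two (hnn a) (hle1 a)
  have h3 : (w.map fun a => -Real.logb 2 (q a) + 1).sum =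
      (w.map fun a => -Real.logb 2 (q a)).sum + w.length := by
    rw [List.sum_map_add]
    simp
  exact (Nat.cast_le.2 h1).trans (h2.trans h3.le)

/-! ### Words of bounded length -/

/-- The words of length less than `N`. -/
def words (Γ : Type*) [Fintype Γ] [DecidableEq Γ] : ℕ → Finset (List Γ)
  | 0 => ∅
  | N + 1 => insert [] ((words Γ N ×ˢ Finset.univ).image fun p : List Γ × Γ => p.2 :: p.1)

section Words

variable {Γ : Type*} [Fintype Γ] [DecidableEq Γ]

theorem mem_words {N : ℕ} {w : List Γ} : w ∈ words Γ N ↔ w.length < N := by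
  induction N generalizing w with
  | zero => simp [words]
  | succ N ih => cases w <;> simp [words, ih]

theorem sum_words_succ (N : ℕ) (f : List Γ → ℝ) :
    ∑ w ∈ words Γ (N + 1), f w = f [] + ∑ w ∈ words Γ N, ∑ a, f (a :: w) := by
  rw [words, Finset.sum_insert (by simp), Finset.sum_image, Finset.sum_product]
  rintro ⟨w, a⟩ - ⟨w', a'⟩ - h
  simp only [List.cons.injEq] at h
  rw [h.1, h.2]

theorem card_words_lt (hΓ : 2 ≤ Fintype.card Γ) (N : ℕ) :
    ((words Γ N).card : ℝ) + 1 ≤ (Fintype.card Γ : ℝ) ^ N := by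
  induction N with
  | zero => simp [words]
  | succ N ih =>
    have h := sum_words_succ (Γ := Γ) N fun _ => 1
    simp only [Finset.sum_const, nsmul_eq_mul, mul_one, Finset.card_univ] at h
    have hΓ' : (2 : ℝ) ≤ Fintype.card Γ := by exact_mod_cast hΓ
    rw [h, pow_succ]
    nlinarith

theorem card_words_one : (words Γ 1).card = 1 := by simp [words]

end Words

/-! ### Superadditive functions of words and full grammars -/

theorem sum_map_le_of_superadditive {Γ β : Type*} (f : List Γ → ℝ) (hnn : ∀ w, 0 ≤ f w)
    (hf : ∀ u v, f u + f v ≤ f (u ++ v)) (e : β → List Γ) (l : List β) :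
    (l.map fun s => f (e s)).sum ≤ f (l.flatMap e) := by
  induction l with
  | nil => simpa using hnn []
  | cons b l ih =>
    rw [List.map_cons, List.sum_cons, List.flatMap_cons]
    linarith [hf (e b) (l.flatMap e)]

namespace FullGrammar

variable {Γ : Type*}

theorem sum_map_concat (G : FullGrammar Γ) (f : Γ ⊕ Fin G.numNT → ℝ) :
    (G.concat.map f).sum = (G.start.map f).sum + ∑ X, ((G.rule X).map f).sum := by
  rw [concat, List.map_append, List.sum_append, List.map_flatMap, List.flatMap,
    List.sum_flatten, List.map_map, ← List.sum_ofFn, List.ofFn_eq_map]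
  rfl

theorem length_concat (G : FullGrammar Γ) :
    G.concat.length = ∑ r, (G.side r).length := by
  rw [Fintype.sum_option, concat, List.length_append, List.length_flatMap, ← List.sum_ofFn,
    List.ofFn_eq_map]
  rfl

theorem lengthBits_eq (G : FullGrammar Γ) :
    G.lengthBits = G.concat.length + G.numNT + 1 := by
  rw [lengthBits, Finset.sum_add_distrib, length_concat]
  simp [add_assoc]

theorem expand_isInfix (G : FullGrammar Γ) {s : Γ ⊕ Fin G.numNT}
    {l : List (Γ ⊕ Fin G.numNT)} (h : s ∈ l) : G.expandSymbol s <:+: l.flatMap G.expandSymbol := by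
  obtain ⟨l₁, l₂, rfl⟩ := List.append_of_mem h
  exact ⟨l₁.flatMap G.expandSymbol, l₂.flatMap G.expandSymbol, by simp⟩

/-- The disjoint pairs of adjacent symbols: the `j`-th one of a right-hand side stands at the
positions `2 * j` and `2 * j + 1`. -/
abbrev PairIndex (G : FullGrammar Γ) : Type :=
  Σ r : Option (Fin G.numNT), Fin ((G.side r).length / 2)

/-- The pair of symbols at a pair index. -/
def pairOf (G : FullGrammar Γ) (p : G.PairIndex) :
    (Γ ⊕ Fin G.numNT) × (Γ ⊕ Fin G.numNT) :=
  ((G.side p.1)[2 * p.2.val]'(by have := p.2.isLt; omega),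
    (G.side p.1)[2 * p.2.val + 1]'(by have := p.2.isLt; omega))

theorem pairAt_pairOf (G : FullGrammar Γ) (p : G.PairIndex) :
    G.PairAt (G.pairOf p).1 (G.pairOf p).2 p.1 (2 * p.2.val) := by
  have := p.2.isLt
  rw [PairAt, List.drop_eq_getElem_cons (by omega), List.drop_eq_getElem_cons (by omega)]
  exact ⟨_, rfl⟩

theorem sum_pairs_le {β : Type*} (h : β → ℝ) (hnn : ∀ b, 0 ≤ h b) (l : List β) :
    ∑ j : Fin (l.length / 2), (h (l[2 * j.val]'(by have := j.isLt; omega)) +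
      h (l[2 * j.val + 1]'(by have := j.isLt; omega))) ≤ (l.map h).sum := by
  let e : Fin (l.length / 2) ⊕ Fin (l.length / 2) ↪ Fin l.length :=
    ⟨Sum.elim (fun j => ⟨2 * j.val, by have := j.isLt; omega⟩)
      (fun j => ⟨2 * j.val + 1, by have := j.isLt; omega⟩), by
      rintro (i | i) (j | j) hij <;> simp [Fin.ext_iff] at hij ⊢ <;> omega⟩
  have h1 : (l.map h).sum = ∑ i : Fin l.length, h l[i] := by
    rw [← List.sum_ofFn]
    congr 1
    apply List.ext_getElem <;> simp
  rw [h1, Finset.sum_add_distrib]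
  calc _ = ∑ x, h l[e x] := by rw [Fintype.sum_sum_type]; rfl
    _ = ∑ i ∈ Finset.univ.map e, h l[i] := by rw [Finset.sum_map]
    _ ≤ _ := Finset.sum_le_univ_sum_of_nonneg fun i => hnn _

variable [DecidableEq Γ]

theorem Irreducible.two_mul_numNT_le [Fintype Γ] {G : FullGrammar Γ} (hG : G.Irreducible) :
    2 * G.numNT ≤ G.concat.length := by
  calc 2 * G.numNT = ∑ X : Fin G.numNT, 2 := by simp [mul_comm]
    _ ≤ ∑ X : Fin G.numNT, G.concat.count (Sum.inr X) :=
        Finset.sum_le_sum fun X _ => hG.two_le_count X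
    _ ≤ ∑ s, G.concat.count s := by rw [Fintype.sum_sum_type]; omega
    _ = G.concat.length := sum_count_eq_length _

/-- By IG2 every nonterminal is used somewhere, either in the starting string or in the rule of a
later nonterminal. Downward induction along the acyclic order then places every expansion inside S,
so the empirical model gives it positive probability. -/
theorem Irreducible.expandSymbol_isInfix {G : FullGrammar Γ} (hG : G.Irreducible) {S : List Γ}
    (hS : G.Generates S) {s : Γ ⊕ Fin G.numNT} (hs : s ∈ G.concat) :
    G.expandSymbol s <:+: S := by
  have key : ∀ m : ℕ, ∀ X : Fin G.numNT, G.numNT ≤ X.val + m → G.expand X <:+: S := by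
    intro m
    induction m with
    | zero => intro X h; omega
    | succ m ih =>
      intro X hX
      have hmem : Sum.inr X ∈ G.concat :=
        List.count_pos_iff.1 (lt_of_lt_of_le two_pos (hG.two_le_count X))
      rw [concat, List.mem_append, List.mem_flatMap] at hmem
      rcases hmem with h | ⟨Y, -, h⟩
      · have := G.expand_isInfix h
        rwa [hS] at this
      · have h1 := G.expand_isInfix h
        rw [← expand_eq] at h1
        have h2 : X.val < Y.val := G.acyclic Y X h
        exact h1.trans (ih Y (by omega))
  rw [concat, List.mem_append, List.mem_flatMap] at hs
  rcases hs with h | ⟨Y, -, h⟩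
  · have := G.expand_isInfix h
    rwa [hS] at this
  · have h1 := G.expand_isInfix h
    rw [← expand_eq] at h1
    exact h1.trans (key G.numNT Y (by omega))

/-- A nonnegative superadditive function of words, summed over the expansions of all symbols of
the concatenation, gives at most twice its value at the generated string. -/
theorem Irreducible.sum_map_concat_le [Fintype Γ] {G : FullGrammar Γ} (hG : G.Irreducible)
    {S : List Γ} (hS : G.Generates S) (f : List Γ → ℝ) (hnn : ∀ w, 0 ≤ f w)
    (hf : ∀ u v, f u + f v ≤ f (u ++ v)) :
    (G.concat.map fun s => f (G.expandSymbol s)).sum ≤ 2 * f S := by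
  have h1 := sum_map_le_of_superadditive f hnn hf G.expandSymbol G.start
  have h2 : ∀ X, ((G.rule X).map fun s => f (G.expandSymbol s)).sum ≤ f (G.expand X) :=
    fun X => by rw [expand_eq]; exact sum_map_le_of_superadditive f hnn hf _ _
  -- With T the sum over S_G and E = ∑ f (exp X), superadditivity in each right-hand side gives T ≤
  -- f S + E, while IG2 gives 2E ≤ T.
  have h3 : 2 * ∑ X, f (G.expand X) ≤ (G.concat.map fun s => f (G.expandSymbol s)).sum := by
    rw [← sum_count_mul_eq_sum_map, Fintype.sum_sum_type, Finset.mul_sum]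
    have h4 : ∀ X, 2 * f (G.expand X) ≤
        (G.concat.count (Sum.inr X) : ℝ) * f (G.expandSymbol (Sum.inr X)) := fun X =>
      mul_le_mul_of_nonneg_right (by exact_mod_cast hG.two_le_count X) (hnn _)
    have h5 : 0 ≤ ∑ a : Γ, (G.concat.count (Sum.inl a) : ℝ) * f (G.expandSymbol (Sum.inl a)) :=
      Finset.sum_nonneg fun a _ => mul_nonneg (Nat.cast_nonneg _) (hnn _)
    linarith [Finset.sum_le_sum fun X (_ : X ∈ Finset.univ) => h4 X]
  have h6 := G.sum_map_concat fun s => f (G.expandSymbol s)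
  rw [hS] at h1
  linarith [Finset.sum_le_sum fun X (_ : X ∈ Finset.univ) => h2 X]

theorem Irreducible.sum_length_le [Fintype Γ] {G : FullGrammar Γ} (hG : G.Irreducible)
    {S : List Γ} (hS : G.Generates S) :
    (G.concat.map fun s => ((G.expandSymbol s).length : ℝ)).sum ≤ 2 * (S.length : ℝ) :=
  hG.sum_map_concat_le hS (fun w => (w.length : ℝ)) (fun _ => Nat.cast_nonneg _)
    (fun u v => by simp)

/-! ### The number of symbols of an irreducible full grammar -/

/-- The factor 2 is needed because a nonterminal may have the same expansion as a letter; within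
each kind, expansions are distinct. -/
theorem Irreducible.card_filter_symbol_le [Fintype Γ] {G : FullGrammar Γ} (hG : G.Irreducible)
    (t : ℕ) : (Finset.univ.filter fun s => (G.expandSymbol s).length < t).card ≤
      2 * (words Γ t).card := by
  have h : (Finset.univ.filter fun s => (G.expandSymbol s).length < t).card ≤
      ((Finset.univ : Finset Bool) ×ˢ words Γ t).card := by
    refine Finset.card_le_card_of_injOn (fun s => (s.isLeft, G.expandSymbol s)) ?_ ?_
    · intro s hs
      have hs' : (G.expandSymbol s).length < t := by simpa using hs
      simp only [Finset.coe_product, Set.mem_prod, Finset.mem_coe, mem_words]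
      exact ⟨Finset.mem_univ _, hs'⟩
    · rintro (a | X) - (b | Y) - h
      · simpa [expandSymbol] using h
      · simp at h
      · simp at h
      · simpa [expandSymbol, hG.expand_injective.eq_iff] using h
  simpa using h

/-- IG3 forces equal pairs into one right-hand side at positions at most one apart, and the
positions considered are all even. -/
theorem Irreducible.pairOf_injective {G : FullGrammar Γ} (hG : G.Irreducible) :
    Function.Injective G.pairOf := by
  rintro ⟨r, i⟩ ⟨r', j⟩ h
  have h1 := G.pairAt_pairOf ⟨r, i⟩
  have h2 := G.pairAt_pairOf ⟨r', j⟩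
  rw [h] at h1
  obtain ⟨rfl, h3, h4⟩ := hG.pair_unique _ _ _ _ _ _ h1 h2
  have : i = j := Fin.ext (by simp only at h3 h4; omega)
  rw [this]

/-- At most (2 · #words)² of the pairs have both expansions shorter than t. Each remaining pair
expands to at least t letters, and all pairs together to at most 2|S|. -/
theorem Irreducible.card_pairIndex_mul_le [Fintype Γ] {G : FullGrammar Γ} (hG : G.Irreducible)
    {S : List Γ} (hS : G.Generates S) (t : ℕ) :
    ((Fintype.card G.PairIndex : ℝ) - 4 * ((words Γ t).card : ℝ) ^ 2) * t ≤ 2 * S.length := by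
  let len : Γ ⊕ Fin G.numNT → ℝ := fun s => ((G.expandSymbol s).length : ℝ)
  have hlen : ∀ s, 0 ≤ len s := fun s => Nat.cast_nonneg _
  let F : Finset G.PairIndex := Finset.univ.filter fun p =>
    (G.expandSymbol (G.pairOf p).1).length < t ∧ (G.expandSymbol (G.pairOf p).2).length < t
  have hF : F.card ≤ (2 * (words Γ t).card) * (2 * (words Γ t).card) := by
    refine le_trans ?_ (Nat.mul_le_mul (hG.card_filter_symbol_le t) (hG.card_filter_symbol_le t))
    rw [← Finset.card_product]
    refine Finset.card_le_card_of_injOn G.pairOf ?_ (hG.pairOf_injective.injOn)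
    intro p hp
    simpa [F] using hp
  have hF' : (F.card : ℝ) ≤ 4 * ((words Γ t).card : ℝ) ^ 2 := by
    have : (F.card : ℝ) ≤ (2 * (words Γ t).card) * (2 * (words Γ t).card) := by exact_mod_cast hF
    linarith
  have htot : ∑ p : G.PairIndex, (len (G.pairOf p).1 + len (G.pairOf p).2) ≤ 2 * S.length := by
    rw [Fintype.sum_sigma]
    refine le_trans (Finset.sum_le_sum fun r _ => sum_pairs_le len hlen (G.side r)) ?_
    rw [Fintype.sum_option]
    have h1 := G.sum_map_concat len
    have h2 := hG.sum_length_le hS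
    exact h1.symm.le.trans h2
  have hlow : (Fᶜ.card : ℝ) * t ≤ ∑ p : G.PairIndex, (len (G.pairOf p).1 + len (G.pairOf p).2) := by
    refine le_trans ?_ (Finset.sum_le_univ_sum_of_nonneg (s := Fᶜ)
      fun p => add_nonneg (hlen _) (hlen _))
    rw [← nsmul_eq_mul]
    refine Finset.card_nsmul_le_sum _ _ _ fun p hp => ?_
    have hp' : ¬ ((G.expandSymbol (G.pairOf p).1).length < t ∧
        (G.expandSymbol (G.pairOf p).2).length < t) := by simpa [F] using hp
    have : t ≤ (G.expandSymbol (G.pairOf p).1).length +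
        (G.expandSymbol (G.pairOf p).2).length := by omega
    simp only [len]
    exact_mod_cast this
  have hc : (Fᶜ.card : ℝ) = Fintype.card G.PairIndex - F.card := by
    rw [Finset.card_compl, Nat.cast_sub (Finset.card_le_univ _)]
  have ht : (0 : ℝ) ≤ t := Nat.cast_nonneg _
  nlinarith

/-- Each right-hand side leaves at most one symbol unpaired, so |S_G| is at most twice the number of
pairs plus the number of nonterminals plus 1; IG2 absorbs the nonterminals into |S_G| / 2. -/
theorem Irreducible.length_concat_le_pairs [Fintype Γ] {G : FullGrammar Γ}
    (hG : G.Irreducible) : G.concat.length ≤ 4 * Fintype.card G.PairIndex + 2 := by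
  have h1 := hG.two_mul_numNT_le
  have h2 : Fintype.card G.PairIndex = ∑ r, (G.side r).length / 2 := by
    rw [Fintype.card_sigma]; simp
  have h3 : G.concat.length ≤ ∑ r, (2 * ((G.side r).length / 2) + 1) := by
    rw [length_concat]
    exact Finset.sum_le_sum fun r _ => by omega
  rw [Finset.sum_add_distrib, ← Finset.mul_sum, ← h2] at h3
  simp only [Finset.sum_const, Finset.card_univ, Fintype.card_option, Fintype.card_fin,
    smul_eq_mul, mul_one] at h3
  omega

/-- An irreducible full grammar for a string of length at most `N` has `O(N / log_σ N)`
symbols. -/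
theorem Irreducible.length_concat_le [Fintype Γ] {G : FullGrammar Γ} (hG : G.Irreducible)
    {S : List Γ} (hS : G.Generates S) (hΓ : 2 ≤ Fintype.card Γ) {N : ℕ} (hN : 2 ≤ N)
    (hSN : S.length ≤ N) :
    (G.concat.length : ℝ) ≤ 150 * ((N : ℝ) / Real.logb (Fintype.card Γ) N) := by
  set σ : ℝ := (Fintype.card Γ : ℝ) with hσdef
  set lam : ℝ := Real.logb σ N with hlam
  set M : ℝ := (Fintype.card G.PairIndex : ℝ) with hM
  have hσ : (2 : ℝ) ≤ σ := by rw [hσdef]; exact_mod_cast hΓ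
  have hN' : (2 : ℝ) ≤ N := by exact_mod_cast hN
  have hS' : (S.length : ℝ) ≤ N := by exact_mod_cast hSN
  have hm : (G.concat.length : ℝ) ≤ 4 * M + 2 := by
    rw [hM]
    exact_mod_cast hG.length_concat_le_pairs
  have hlpos : 0 < lam := Real.logb_pos (by linarith) (by linarith)
  have hcount := hG.card_pairIndex_mul_le hS
  simp only [← hM] at hcount
  rw [← mul_div_assoc, le_div_iff₀ hlpos]
  -- For small λ the linear bound from t = 1 suffices: |S_G| ≤ 8N + 18 ≤ 17N.
  rcases lt_or_ge lam 4 with hl4 | hl4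
  · have h1 := hcount 1
    rw [card_words_one, Nat.cast_one, one_pow, mul_one, mul_one] at h1
    have h2 : (G.concat.length : ℝ) ≤ 17 * N := by linarith
    nlinarith
  -- This t keeps the number of pairs of short words below σ ^ (λ / 2) = √N, up to a constant, while
  -- λ < 8t.
  · set t : ℕ := ⌊lam / 4⌋₊ with ht
    have ht1 : (1 : ℝ) ≤ t := by
      have : 1 ≤ t := Nat.le_floor (by push_cast; linarith)
      exact_mod_cast this
    have htle : (t : ℝ) ≤ lam / 4 := Nat.floor_le (by linarith)
    have htlt : lam / 4 < t + 1 := Nat.lt_floor_add_one _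
    have hw := card_words_lt hΓ t
    have hwnn : (0 : ℝ) ≤ (words Γ t).card := Nat.cast_nonneg _
    have hw2 : ((words Γ t).card : ℝ) ^ 2 ≤ √N := by
      apply Real.le_sqrt_of_sq_le
      have h1 : ((words Γ t).card : ℝ) ≤ σ ^ t := by linarith
      have h2 : (((words Γ t).card : ℝ) ^ 2) ^ 2 ≤ (σ ^ t) ^ 4 := by
        rw [← pow_mul]
        exact pow_le_pow_left₀ hwnn h1 4
      refine h2.trans ?_
      rw [← pow_mul, ← Real.rpow_natCast]
      calc σ ^ ((t * 4 : ℕ) : ℝ) ≤ σ ^ lam :=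
            Real.rpow_le_rpow_of_exponent_le (by linarith) (by push_cast; linarith)
        _ = N := Real.rpow_logb (by linarith) (by linarith) (by linarith)
    have hsq : √(N : ℝ) * √N = N := Real.mul_self_sqrt (by linarith)
    have hsq1 : 1 ≤ √(N : ℝ) := Real.one_le_sqrt.2 (by linarith)
    have hlamle : lam ≤ 4 * √N := by
      have hlogN : Real.log N ≤ 2 * √N := by
        have h1 := Real.log_le_sub_one_of_pos (x := √(N : ℝ)) (by linarith)
        rw [Real.log_sqrt (by linarith)] at h1
        linarith
      have hlogσ : 1 / 2 ≤ Real.log σ := by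
        have := Real.log_le_log two_pos hσ
        linarith [Real.log_two_gt_d9]
      rw [hlam, Real.logb, div_le_iff₀ (by linarith)]
      nlinarith
    have h1 := hcount t
    have h2 : (M - 4 * √N) * t ≤ 2 * N := by nlinarith
    have h3 : (M - 4 * √N) * lam ≤ 16 * N := by
      rcases le_total 0 (M - 4 * √N) with h | h
      · nlinarith
      · nlinarith
    have h4 : (G.concat.length : ℝ) * lam ≤ (4 * M + 2) * lam :=
      mul_le_mul_of_nonneg_right hm hlpos.le
    have h5 : lam * √N ≤ 4 * N := by nlinarith
    have h6 : √(N : ℝ) ≤ N := by nlinarith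
    linarith

end FullGrammar

/-! ### Occurrences of words -/

section Occ

variable {α : Type*} [DecidableEq α]

theorem occ_cons (x : List α) (b : α) (w : List α) :
    occ x (b :: w) = (if x <+: b :: w then 1 else 0) + occ x w := by
  simp only [occ, List.length_cons, Finset.card_filter]
  rw [Finset.sum_range_succ']
  simp [add_comm]

theorem occ_append_le (x u v : List α) : occ x u + occ x v ≤ occ x (u ++ v) := by
  induction u with
  | nil => simp [occ]
  | cons b u ih =>
    rw [List.cons_append, occ_cons, occ_cons]
    have h : x <+: b :: u → x <+: b :: (u ++ v) := fun h =>
      h.trans (by rw [← List.cons_append]; exact List.prefix_append _ _)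
    split_ifs with h1 h2
    · omega
    · exact absurd (h h1) h2
    · omega
    · omega

theorem occ_pos_of_isInfix {x w : List α} (hx : x ≠ []) (h : x <:+: w) : 0 < occ x w := by
  obtain ⟨u, v, rfl⟩ := h
  rw [occ, Finset.card_pos]
  refine ⟨u.length, ?_⟩
  have := List.length_pos_iff.2 hx
  simp only [Finset.mem_filter, Finset.mem_range, List.length_append]
  refine ⟨by omega, ?_⟩
  rw [List.append_assoc, List.drop_left]
  exact List.prefix_append _ _

theorem occ_concat_ge {x u : List α} {b : α} (hx : x ≠ []) (h : x <:+ u ++ [b]) :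
    occ x u + 1 ≤ occ x (u ++ [b]) := by
  induction u with
  | nil =>
    have := occ_pos_of_isInfix hx h.isInfix
    simpa [occ] using this
  | cons c u ih =>
    rw [List.cons_append, occ_cons, occ_cons]
    rw [List.cons_append, List.suffix_cons_iff] at h
    have hp : x <+: c :: u → x <+: c :: (u ++ [b]) := fun h =>
      h.trans (by rw [← List.cons_append]; exact List.prefix_append _ _)
    rcases h with h | h
    · have h1 : ¬ x <+: c :: u := by
        intro h'
        have := h'.length_le
        rw [h] at this
        simp at this
      have h2 : x <+: c :: (u ++ [b]) := h ▸ List.prefix_refl _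
      rw [if_neg h1, if_pos h2]
      have := occ_append_le x u [b]
      omega
    · have := ih h
      split_ifs with h1 h2
      · omega
      · exact absurd (hp h1) h2
      · omega
      · omega

/-- An occurrence of v is followed by at most one letter. Equality fails when v ends the word, which
is why the empirical model is only a subprobability. -/
theorem sum_occ_concat_le [Fintype α] (v w : List α) :
    ∑ a, occ (v ++ [a]) w ≤ occ v w := by
  induction w with
  | nil => simp [occ]
  | cons b w ih =>
    simp only [occ_cons, Finset.sum_add_distrib]
    refine add_le_add ?_ ih
    by_cases hv : v <+: b :: w
    · rw [if_pos hv, ← Finset.card_filter, Finset.card_le_one]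
      intro a ha a' ha'
      simp only [Finset.mem_filter, Finset.mem_univ, true_and] at ha ha'
      have h := (List.prefix_of_prefix_length_le ha ha' (by simp)).eq_of_length (by simp)
      simpa using h
    · rw [if_neg hv, Finset.sum_eq_zero]
      intro a _
      exact if_neg fun h => hv ((List.prefix_append _ _).trans h)

theorem occ_concat_le [Fintype α] (v w : List α) (a : α) : occ (v ++ [a]) w ≤ occ v w :=
  (Finset.single_le_sum (f := fun a => occ (v ++ [a]) w) (fun _ _ => Nat.zero_le _)
    (Finset.mem_univ a)).trans (sum_occ_concat_le v w)

end Occ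

/-! ### The empirical `k`-order model of a string -/

section Model

variable {Γ : Type*} [Fintype Γ] [DecidableEq Γ]

/-- The number of bits of the letter `a` after the context `v` in the empirical model of `S`. -/
noncomputable def letterCost (S v : List Γ) (a : Γ) : ℝ :=
  -Real.logb 2 ((occ (v ++ [a]) S : ℝ) / (occ v S : ℝ))

theorem letterCost_nonneg (S v : List Γ) (a : Γ) : 0 ≤ letterCost S v a := by
  rw [letterCost, neg_nonneg]
  refine Real.logb_nonpos one_lt_two (by positivity) (div_le_one_of_le₀ ?_ (Nat.cast_nonneg _))
  exact_mod_cast occ_concat_le v S a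

/-- The number of bits, in the empirical `k`-order model of `S`, of all letters of `w` that have
at least `k` predecessors in `w`. -/
noncomputable def modelCost (k : ℕ) (S w : List Γ) : ℝ :=
  ∑ v : Fin k → Γ, ∑ a : Γ,
    (occ (List.ofFn v ++ [a]) w : ℝ) * letterCost S (List.ofFn v) a

theorem modelCost_self (k : ℕ) (S : List Γ) :
    modelCost k S S = (S.length : ℝ) * entropy k S := by
  rcases eq_or_ne S [] with rfl | hS
  · simp [modelCost, occ]
  have : (S.length : ℝ) ≠ 0 := by exact_mod_cast (List.length_pos_iff.2 hS).ne'
  simp only [modelCost, entropy, letterCost, mul_neg, Finset.sum_neg_distrib]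
  field_simp

theorem modelCost_nonneg (k : ℕ) (S w : List Γ) : 0 ≤ modelCost k S w :=
  Finset.sum_nonneg fun _ _ => Finset.sum_nonneg fun _ _ =>
    mul_nonneg (Nat.cast_nonneg _) (letterCost_nonneg _ _ _)

theorem modelCost_append_le (k : ℕ) (S u v : List Γ) :
    modelCost k S u + modelCost k S v ≤ modelCost k S (u ++ v) := by
  simp only [modelCost, ← Finset.sum_add_distrib, ← add_mul]
  refine Finset.sum_le_sum fun x _ => Finset.sum_le_sum fun a _ =>
    mul_le_mul_of_nonneg_right ?_ (letterCost_nonneg _ _ _)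
  exact_mod_cast occ_append_le _ u v

/-- Appending b after the context v creates a new occurrence of v b, and no occurrence is lost. -/
theorem modelCost_concat_ge {k : ℕ} (S : List Γ) {u v : List Γ} {b : Γ} (hv : v.length = k)
    (h : v <:+ u) : modelCost k S u + letterCost S v b ≤ modelCost k S (u ++ [b]) := by
  subst hv
  let x : Fin v.length → Γ := v.get
  have hx : List.ofFn x = v := List.ofFn_get v
  have hsum : modelCost v.length S (u ++ [b]) - modelCost v.length S u =
      ∑ v' : Fin v.length → Γ, ∑ a : Γ, ((occ (List.ofFn v' ++ [a]) (u ++ [b]) : ℝ) -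
        occ (List.ofFn v' ++ [a]) u) * letterCost S (List.ofFn v') a := by
    simp only [modelCost, ← Finset.sum_sub_distrib, ← sub_mul]
  have hnn : ∀ (v' : Fin v.length → Γ) (a : Γ), 0 ≤ ((occ (List.ofFn v' ++ [a]) (u ++ [b]) : ℝ) -
        occ (List.ofFn v' ++ [a]) u) * letterCost S (List.ofFn v') a := by
    intro v' a
    refine mul_nonneg ?_ (letterCost_nonneg _ _ _)
    rw [sub_nonneg]
    exact_mod_cast (Nat.le_add_right _ _).trans (occ_append_le _ u [b])
  have h1 : letterCost S v b ≤ ((occ (List.ofFn x ++ [b]) (u ++ [b]) : ℝ) -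
        occ (List.ofFn x ++ [b]) u) * letterCost S (List.ofFn x) b := by
    rw [hx]
    refine le_mul_of_one_le_left (letterCost_nonneg _ _ _) ?_
    have h2 : occ (v ++ [b]) u + 1 ≤ occ (v ++ [b]) (u ++ [b]) :=
      occ_concat_ge (by simp) (by
        obtain ⟨t, rfl⟩ := h
        exact ⟨t, by simp⟩)
    have h3 : (occ (v ++ [b]) u : ℝ) + 1 ≤ occ (v ++ [b]) (u ++ [b]) := by exact_mod_cast h2
    linarith
  have h2 := Finset.single_le_sum (f := fun a => ((occ (List.ofFn x ++ [a]) (u ++ [b]) : ℝ) -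
    occ (List.ofFn x ++ [a]) u) * letterCost S (List.ofFn x) a) (fun a _ => hnn x a)
    (Finset.mem_univ b)
  have h3 := Finset.single_le_sum (f := fun v' : Fin v.length → Γ => ∑ a : Γ,
    ((occ (List.ofFn v' ++ [a]) (u ++ [b]) : ℝ) -
    occ (List.ofFn v' ++ [a]) u) * letterCost S (List.ofFn v') a)
    (fun v' _ => Finset.sum_nonneg fun a _ => hnn v' a) (Finset.mem_univ x)
  linarith

/-- The probability of the letter `b` after the reversed word `w`: uniform for the first `k`
letters, that of the empirical `k`-order model of `S` for the others. -/
noncomputable def letterProb (k : ℕ) (S w : List Γ) (b : Γ) : ℝ :=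
  if w.length < k then 1 / Fintype.card Γ
  else (occ ((w.take k).reverse ++ [b]) S : ℝ) / occ (w.take k).reverse S

theorem letterProb_nonneg (k : ℕ) (S w : List Γ) (b : Γ) : 0 ≤ letterProb k S w b := by
  rw [letterProb]
  split_ifs <;> positivity

theorem sum_letterProb_le (k : ℕ) (S w : List Γ) : ∑ b, letterProb k S w b ≤ 1 := by
  simp only [letterProb]
  split_ifs
  · simp only [Finset.sum_const, Finset.card_univ, nsmul_eq_mul, mul_one_div]
    exact div_self_le_one _
  · rw [← Finset.sum_div]
    refine div_le_one_of_le₀ ?_ (Nat.cast_nonneg _)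
    exact_mod_cast sum_occ_concat_le _ S

/-- The probability of a reversed word, where every letter costs in addition the factor `p`, the
probability not to stop. -/
noncomputable def wordWeight (p : ℝ) (k : ℕ) (S : List Γ) : List Γ → ℝ
  | [] => 1
  | b :: w => p * letterProb k S w b * wordWeight p k S w

theorem wordWeight_nonneg {p : ℝ} (hp : 0 ≤ p) (k : ℕ) (S w : List Γ) :
    0 ≤ wordWeight p k S w := by
  induction w with
  | nil => simp [wordWeight]
  | cons b w ih => exact mul_nonneg (mul_nonneg hp (letterProb_nonneg _ _ _ _)) ih

/-- The sums W_N satisfy W_{N+1} ≤ 1 + p W_N, the recursion of the geometric series. -/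
theorem sum_words_wordWeight_le {p : ℝ} (hp : 0 ≤ p) (hp1 : p ≤ 1) (k : ℕ) (S : List Γ) (N : ℕ) :
    (1 - p) * ∑ w ∈ words Γ N, wordWeight p k S w ≤ 1 := by
  induction N with
  | zero => simp [words]
  | succ N ih =>
    rw [sum_words_succ]
    have h : ∑ w ∈ words Γ N, ∑ a, wordWeight p k S (a :: w) ≤
        p * ∑ w ∈ words Γ N, wordWeight p k S w := by
      rw [Finset.mul_sum]
      refine Finset.sum_le_sum fun w _ => ?_
      simp only [wordWeight]
      rw [← Finset.sum_mul, ← Finset.mul_sum]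
      refine mul_le_mul_of_nonneg_right ?_ (wordWeight_nonneg hp k S w)
      exact mul_le_of_le_one_right hp (sum_letterProb_le k S w)
    have h0 : wordWeight p k S [] = 1 := rfl
    rw [h0]
    nlinarith [mul_le_mul_of_nonneg_left h (sub_nonneg.2 hp1), mul_le_mul_of_nonneg_left ih hp]

theorem sum_wordWeight_le {β : Type*} [Fintype β] {p : ℝ} (hp : 0 ≤ p) (hp1 : p ≤ 1)
    (k : ℕ) (S : List Γ) (e : β → List Γ) (he : Function.Injective e) :
    (1 - p) * ∑ s, wordWeight p k S (e s).reverse ≤ 1 := by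
  classical
  refine le_trans (mul_le_mul_of_nonneg_left ?_ (by linarith))
    (sum_words_wordWeight_le hp hp1 k S ((∑ s, (e s).length) + 1))
  rw [← Finset.sum_image (f := wordWeight p k S) (g := fun s => (e s).reverse) (s := Finset.univ)
    (fun s _ s' _ h => he (List.reverse_injective h))]
  refine Finset.sum_le_sum_of_subset_of_nonneg ?_ fun w _ _ => wordWeight_nonneg hp k S w
  intro w hw
  obtain ⟨s, -, rfl⟩ := Finset.mem_image.1 hw
  rw [mem_words, List.length_reverse, Nat.lt_succ_iff]
  exact Finset.single_le_sum (f := fun s => (e s).length) (fun _ _ => Nat.zero_le _)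
    (Finset.mem_univ s)

/-- Words are reversed so that consing a letter extends the expansion on the right, with its context
at the head of the list. Each of the first k letters costs log σ; each later one costs its
`letterCost`, which the growth of `modelCost` pays for. -/
theorem wordWeight_reverse {p : ℝ} (hp : 0 < p) (k : ℕ) (S : List Γ) (w : List Γ)
    (hw : w.reverse <:+: S) : 0 < wordWeight p k S w ∧
      -Real.logb 2 (wordWeight p k S w) ≤ w.length * -Real.logb 2 p +
        (min w.length k : ℕ) * Real.logb 2 (Fintype.card Γ) + modelCost k S w.reverse := by
  induction w with
  | nil => simpa [wordWeight] using modelCost_nonneg k S []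
  | cons b w ih =>
    rw [List.reverse_cons] at hw ⊢
    obtain ⟨hpos, hle⟩ := ih ((List.prefix_append _ _).isInfix.trans hw)
    have hcard : (0 : ℝ) < Fintype.card Γ := by exact_mod_cast Fintype.card_pos_iff.2 ⟨b⟩
    have hprob : 0 < letterProb k S w b ∧
        -Real.logb 2 (letterProb k S w b) +
          (min w.length k : ℕ) * Real.logb 2 (Fintype.card Γ) + modelCost k S w.reverse ≤
        (min (w.length + 1) k : ℕ) * Real.logb 2 (Fintype.card Γ) +
          modelCost k S (w.reverse ++ [b]) := by
      rw [letterProb]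
      split_ifs with hk
      · refine ⟨by positivity, ?_⟩
        rw [one_div, Real.logb_inv, neg_neg, min_eq_left hk.le, min_eq_left hk]
        have := modelCost_append_le k S w.reverse [b]
        have := modelCost_nonneg k S [b]
        push_cast
        linarith
      · have hlen : (w.take k).reverse.length = k := by simp; omega
        have hsuf : (w.take k).reverse <:+ w.reverse := by
          rw [List.reverse_suffix]
          exact List.take_prefix k w
        have hinf : (w.take k).reverse ++ [b] <:+: S := by
          refine List.IsInfix.trans (List.IsSuffix.isInfix ?_) hw
          obtain ⟨t, ht⟩ := hsuf
          exact ⟨t, by rw [← ht, List.append_assoc]⟩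
        have h1 : 0 < occ ((w.take k).reverse ++ [b]) S := occ_pos_of_isInfix (by simp) hinf
        have h2 := h1.trans_le (occ_concat_le (w.take k).reverse S b)
        refine ⟨div_pos (by exact_mod_cast h1) (by exact_mod_cast h2), ?_⟩
        have h3 := modelCost_concat_ge (b := b) S hlen hsuf
        rw [letterCost] at h3
        rw [min_eq_right (by omega), min_eq_right (by omega)]
        linarith
    refine ⟨mul_pos (mul_pos hp hprob.1) hpos, ?_⟩
    rw [wordWeight, Real.logb_mul (mul_pos hp hprob.1).ne' hpos.ne',
      Real.logb_mul hp.ne' hprob.1.ne', List.length_cons]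
    push_cast at hprob hle ⊢
    linarith [hprob.2]

end Model

/-! ### The size of the codings for a fixed string -/

/-- The redundancy of the codings, for strings of length `N` over `σ` letters. -/
noncomputable def redundancy (σ k N : ℕ) : ℝ :=
  150 * ((N : ℝ) / Real.logb σ N) *
      (6 + Real.logb 2 (Real.logb σ N + 1) + k * Real.logb 2 σ) +
    4 * ((N : ℝ) / Real.logb σ N) + (min σ N : ℕ) + 1

namespace FullGrammar

variable {Γ : Type*} [Fintype Γ] [DecidableEq Γ]

/-- A subprobability distribution on the symbols of a full grammar: the expansion of a symbol is
generated letter by letter, and the generation goes on with probability `p` after each letter. -/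
noncomputable def symbolProb (G : FullGrammar Γ) (p : ℝ) (k : ℕ) (S : List Γ)
    (s : Γ ⊕ Fin G.numNT) : ℝ :=
  1 / 2 * (1 - p) * wordWeight p k S (G.expandSymbol s).reverse

theorem symbolProb_nonneg (G : FullGrammar Γ) {p : ℝ} (hp : 0 ≤ p) (hp1 : p ≤ 1) (k : ℕ)
    (S : List Γ) (s : Γ ⊕ Fin G.numNT) : 0 ≤ G.symbolProb p k S s :=
  mul_nonneg (mul_nonneg (by norm_num) (by linarith)) (wordWeight_nonneg hp _ _ _)

/-- Letters and nonterminals each receive at most half of the mass, since expansions are injective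
only within each kind. -/
theorem Irreducible.sum_symbolProb_le {G : FullGrammar Γ} (hG : G.Irreducible) {p : ℝ}
    (hp : 0 ≤ p) (hp1 : p ≤ 1) (k : ℕ) (S : List Γ) : ∑ s, G.symbolProb p k S s ≤ 1 := by
  have h1 := sum_wordWeight_le hp hp1 k S (fun a : Γ => [a]) List.singleton_injective
  have h2 := sum_wordWeight_le hp hp1 k S G.expand hG.expand_injective
  simp only [symbolProb, ← Finset.mul_sum]
  rw [Fintype.sum_sum_type]
  simp only [expandSymbol]
  linarith

theorem Irreducible.symbolProb_pos {G : FullGrammar Γ} (hG : G.Irreducible) {S : List Γ}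
    (hS : G.Generates S) {p : ℝ} (hp : 0 < p) (hp1 : p < 1) (k : ℕ) {s : Γ ⊕ Fin G.numNT}
    (hs : s ∈ G.concat) : 0 < G.symbolProb p k S s :=
  mul_pos (mul_pos (by norm_num) (by linarith)) (wordWeight_reverse hp k S _ (by
    rw [List.reverse_reverse]
    exact hG.expandSymbol_isInfix hS hs)).1

/-- The choice p = λ/(λ + 1) balances stopping, log(λ + 1) bits per symbol, against continuing, at
most 2/λ bits per letter of an expansion; these letters number at most 2|S|. -/
theorem Irreducible.sum_neg_logb_symbolProb_le {G : FullGrammar Γ} (hG : G.Irreducible)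
    {S : List Γ} (hS : G.Generates S) (hΓ : 2 ≤ Fintype.card Γ) {lam : ℝ} (hlam : 0 < lam)
    (k : ℕ) :
    (G.concat.map fun s => -Real.logb 2 (G.symbolProb (lam / (lam + 1)) k S s)).sum ≤
      G.concat.length * (1 + Real.logb 2 (lam + 1) + k * Real.logb 2 (Fintype.card Γ)) +
        4 * S.length / lam + 2 * S.length * entropy k S := by
  set p : ℝ := lam / (lam + 1) with hpdef
  have hp : 0 < p := by positivity
  have h1p : 1 - p = (lam + 1)⁻¹ := by rw [hpdef]; field_simp; ring
  have hinv : 0 < (lam + 1)⁻¹ := by positivity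
  have hlogσ : 0 ≤ Real.logb 2 (Fintype.card Γ) :=
    Real.logb_nonneg one_lt_two (by exact_mod_cast one_le_two.trans hΓ)
  set K : ℝ := 1 + Real.logb 2 (lam + 1) + k * Real.logb 2 (Fintype.card Γ) with hK
  have hlogp : -Real.logb 2 p ≤ 2 / lam := by
    have h1 : -Real.log p ≤ 1 / lam := by
      have h2 := Real.log_le_sub_one_of_pos (x := p⁻¹) (by positivity)
      rw [Real.log_inv] at h2
      refine h2.trans (le_of_eq ?_)
      rw [hpdef]
      field_simp
      ring
    have h3 := Real.log_two_gt_d9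
    rw [Real.logb, ← neg_div, div_le_iff₀ (by linarith)]
    refine h1.trans ?_
    rw [div_mul_eq_mul_div]
    gcongr
    linarith
  have hlogp0 : 0 ≤ -Real.logb 2 p :=
    neg_nonneg.2 (Real.logb_nonpos one_lt_two hp.le (by linarith))
  have hsym : ∀ s ∈ G.concat, -Real.logb 2 (G.symbolProb p k S s) ≤
      (K + (-Real.logb 2 p) * ((G.expandSymbol s).length : ℝ)) +
        modelCost k S (G.expandSymbol s) := by
    intro s hs
    obtain ⟨h1, h2⟩ := wordWeight_reverse hp k S (G.expandSymbol s).reverse (by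
      rw [List.reverse_reverse]
      exact hG.expandSymbol_isInfix hS hs)
    rw [List.reverse_reverse, List.length_reverse] at h2
    have h3 : ((min (G.expandSymbol s).length k : ℕ) : ℝ) * Real.logb 2 (Fintype.card Γ) ≤
        k * Real.logb 2 (Fintype.card Γ) :=
      mul_le_mul_of_nonneg_right (by exact_mod_cast min_le_right _ _) hlogσ
    rw [symbolProb, h1p, Real.logb_mul (by positivity) h1.ne',
      Real.logb_mul (by norm_num) hinv.ne', one_div, Real.logb_inv, Real.logb_inv,
      Real.logb_self_eq_one one_lt_two]
    linarith
  have h1 := List.sum_le_sum hsym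
  rw [List.sum_map_add, List.sum_map_add, List.sum_map_mul_left, List.map_const',
    List.sum_replicate, nsmul_eq_mul] at h1
  have h2 := hG.sum_map_concat_le hS (modelCost k S) (modelCost_nonneg k S)
    (modelCost_append_le k S)
  rw [modelCost_self] at h2
  have h3 := hG.sum_length_le hS
  have h4 : -Real.logb 2 p * (G.concat.map fun s => ((G.expandSymbol s).length : ℝ)).sum ≤
      2 / lam * (2 * S.length) :=
    (mul_le_mul_of_nonneg_left h3 hlogp0).trans
      (mul_le_mul_of_nonneg_right hlogp (by positivity))
  have h5 : 2 / lam * (2 * (S.length : ℝ)) = 4 * S.length / lam := by ring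
  linarith

/-- Both codings take `2 |S| H_k(S)` bits up to the redundancy. -/
theorem Irreducible.size_le {G : FullGrammar Γ} (hG : G.Irreducible)
    {S : List Γ} (hS : G.Generates S) (hΓ : 2 ≤ Fintype.card Γ) {N : ℕ} (hN : 2 ≤ N)
    (hSN : S.length ≤ N) (k : ℕ) :
    G.entropyCodingSize ≤ 2 * S.length * entropy k S + redundancy (Fintype.card Γ) k N ∧
    (Fintype.card Γ ≤ N → ∀ c, IsOptimalPrefixCode c G.concat →
      (G.prefixCodingSize c : ℝ) ≤
        2 * S.length * entropy k S + redundancy (Fintype.card Γ) k N) := by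
  have hm := hG.length_concat_le hS hΓ hN hSN
  have hlpos : 0 < Real.logb (Fintype.card Γ) N :=
    Real.logb_pos (by exact_mod_cast hΓ) (by exact_mod_cast hN)
  set lam := Real.logb (Fintype.card Γ) N with hlam
  set m : ℝ := (G.concat.length : ℝ) with hmdef
  have hlog1 : 0 ≤ Real.logb 2 (lam + 1) := Real.logb_nonneg one_lt_two (by linarith)
  have hlogσ : 0 ≤ Real.logb 2 (Fintype.card Γ : ℝ) :=
    Real.logb_nonneg one_lt_two (by exact_mod_cast one_le_two.trans hΓ)
  have hkl : 0 ≤ (k : ℝ) * Real.logb 2 (Fintype.card Γ : ℝ) := by positivity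
  have hp : 0 < lam / (lam + 1) := by positivity
  have hp1 : lam / (lam + 1) < 1 := by rw [div_lt_one (by positivity)]; linarith
  have hsum := hG.sum_neg_logb_symbolProb_le hS hΓ hlpos k
  have hpos := fun s hs => hG.symbolProb_pos hS hp hp1 k (s := s) hs
  have hnn := G.symbolProb_nonneg hp.le hp1.le k S
  have hone := hG.sum_symbolProb_le hp.le hp1.le k S
  have hent := length_mul_entropy_zero_le G.concat _ hpos hnn hone
  have hnt : (2 : ℝ) * G.numNT ≤ m := by
    rw [hmdef]
    exact_mod_cast hG.two_mul_numNT_le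
  have hlb : (G.lengthBits : ℝ) = m + G.numNT + 1 := by
    rw [hmdef]
    exact_mod_cast G.lengthBits_eq
  have hdiv : 4 * (S.length : ℝ) / lam ≤ 4 * ((N : ℝ) / lam) := by
    rw [mul_div_assoc]
    have : (S.length : ℝ) ≤ N := by exact_mod_cast hSN
    gcongr
  have hmin : (0 : ℝ) ≤ (min (Fintype.card Γ) N : ℕ) := Nat.cast_nonneg _
  -- The constant 6 leaves room for the prefix code: per symbol of S_G, one bit each for the factor
  -- 1/2 in q, the rounding, the frequency table and the unary lengths, and at most one for the
  -- terminators of nonterminals in both unary lists. The terminators of letters give `min σ N`.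
  have hred : m * (6 + Real.logb 2 (lam + 1) + k * Real.logb 2 (Fintype.card Γ : ℝ)) +
      4 * ((N : ℝ) / lam) + (min (Fintype.card Γ) N : ℕ) + 1 ≤ redundancy (Fintype.card Γ) k N := by
    have h0 : 0 ≤ 6 + Real.logb 2 (lam + 1) + k * Real.logb 2 (Fintype.card Γ : ℝ) := by linarith
    have h1 := mul_le_mul_of_nonneg_right hm h0
    have h2 : 0 ≤ (N : ℝ) / lam := by positivity
    rw [redundancy, ← hlam]
    linarith
  have hm0 : 0 ≤ m := Nat.cast_nonneg _
  refine ⟨?_, fun hσN c hc => ?_⟩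
  · rw [entropyCodingSize, hlb]
    linarith
  · have hcode := hc.codedLength_le _ hpos hnn hone
    have htab : ((∑ s : Γ ⊕ Fin G.numNT, (G.concat.count s + 1) : ℕ) : ℝ) =
        m + (Fintype.card Γ + G.numNT) := by
      rw [Finset.sum_add_distrib, sum_count_eq_length]
      simp [hmdef]
    rw [min_eq_left hσN] at hred
    rw [prefixCodingSize, Nat.cast_add, Nat.cast_add, htab, hlb]
    linarith

end FullGrammar

/-! ### The redundancy is of lower order -/

/-- Since n / log_σ n = n log σ / log n, dividing by n log σ leaves terms of order 1 / log n, log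
log n / log n and k / log_σ n, besides the table term and 1/n. -/
theorem redundancy_isLittleO (σ k : ℕ → ℕ) (hσ : ∀ n, 2 ≤ σ n)
    (hk : (fun n : ℕ => (k n : ℝ)) =o[atTop] fun n : ℕ => Real.logb (σ n) n) :
    (fun n => redundancy (σ n) (k n) (max n 2)) =o[atTop]
      fun n : ℕ => (n : ℝ) * Real.logb 2 (σ n) := by
  have hcast : Tendsto (fun n : ℕ => (n : ℝ)) atTop atTop := tendsto_natCast_atTop_atTop
  have hlog : Tendsto (fun n : ℕ => Real.logb 2 n) atTop atTop :=
    (Real.tendsto_logb_atTop one_lt_two).comp hcast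
  have hinv : Tendsto (fun n : ℕ => (Real.logb 2 n)⁻¹) atTop (nhds 0) := hlog.inv_tendsto_atTop
  have hloglog : Tendsto (fun n : ℕ => Real.logb 2 (Real.logb 2 n + 1) / Real.logb 2 n) atTop
      (nhds 0) := by
    have h1 : Tendsto (fun x : ℝ => Real.logb 2 (x + 1) / x) atTop (nhds 0) := by
      have h2 : (fun x : ℝ => Real.logb 2 (x + 1)) =o[atTop] fun x => x := by
        have h3 : (fun x : ℝ => Real.log (x + 1)) =o[atTop] fun x => x + 1 :=
          Real.isLittleO_log_id_atTop.comp_tendsto (tendsto_atTop_add_const_right _ 1 tendsto_id)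
        have h4 : (fun x : ℝ => x + 1) =O[atTop] fun x => x :=
          (isBigO_refl _ _).add (isLittleO_const_id_atTop (1 : ℝ)).isBigO
        exact ((h3.trans_isBigO h4).const_mul_left (Real.log 2)⁻¹).congr_left
          fun x => by rw [Real.logb, div_eq_inv_mul]
      exact h2.tendsto_div_nhds_zero
    exact h1.comp hlog
  have hkdiv := hk.tendsto_div_nhds_zero
  have hsqrt : Tendsto (fun n : ℕ => (√(n : ℝ))⁻¹) atTop (nhds 0) :=
    (Real.tendsto_sqrt_atTop.comp hcast).inv_tendsto_atTop
  have hinvn : Tendsto (fun n : ℕ => ((n : ℝ))⁻¹) atTop (nhds 0) := hcast.inv_tendsto_atTop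
  let ε : ℕ → ℝ := fun n =>
    150 * (6 * (Real.logb 2 n)⁻¹ + Real.logb 2 (Real.logb 2 n + 1) / Real.logb 2 n +
      k n / Real.logb (σ n) n) + 4 * (Real.logb 2 n)⁻¹ +
      ((√(n : ℝ))⁻¹ + 2 * (Real.logb 2 n)⁻¹) + (n : ℝ)⁻¹
  have hε : Tendsto ε atTop (nhds 0) := by
    have h := (((((hinv.const_mul 6).add hloglog).add hkdiv).const_mul 150).add
      (hinv.const_mul 4)).add (hsqrt.add (hinv.const_mul 2)) |>.add hinvn
    simpa [ε] using h
  have hbound : (fun n => redundancy (σ n) (k n) (max n 2)) =O[atTop]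
      fun n : ℕ => ε n * ((n : ℝ) * Real.logb 2 (σ n)) := by
    refine IsBigO.of_bound 1 ?_
    filter_upwards [eventually_ge_atTop 2] with n hn
    rw [max_eq_left hn, one_mul]
    have hn' : (2 : ℝ) ≤ n := by exact_mod_cast hn
    have hσ' : (2 : ℝ) ≤ σ n := by exact_mod_cast hσ n
    have hlσ : 1 ≤ Real.logb 2 (σ n) := by
      rw [Real.le_logb_iff_rpow_le one_lt_two (by linarith)]; simpa using hσ'
    have hln : 1 ≤ Real.logb 2 (n : ℝ) := by
      rw [Real.le_logb_iff_rpow_le one_lt_two (by linarith)]; simpa using hn'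
    have hlam : Real.logb (σ n) n = Real.logb 2 n / Real.logb 2 (σ n) := by
      have : Real.log 2 ≠ 0 := (Real.log_pos one_lt_two).ne'
      simp only [Real.logb]
      field_simp
    have hlam0 : 0 < Real.logb (σ n) n := Real.logb_pos (by linarith) (by linarith)
    have hlamle : Real.logb (σ n) n ≤ Real.logb 2 n := by
      rw [hlam]; exact div_le_self (by linarith) hlσ
    have hll : Real.logb 2 (Real.logb (σ n) n + 1) ≤ Real.logb 2 (Real.logb 2 n + 1) :=
      Real.logb_le_logb_of_le one_lt_two (by linarith) (by linarith)
    have hll0 : 0 ≤ Real.logb 2 (Real.logb (σ n) n + 1) :=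
      Real.logb_nonneg one_lt_two (by linarith)
    -- If σ ≤ √n, the minimum is at most √n; otherwise log n ≤ 2 log σ, so n ≤ 2 n log σ / log n.
    have hmin : ((min (σ n) n : ℕ) : ℝ) ≤
        ((√(n : ℝ))⁻¹ + 2 * (Real.logb 2 n)⁻¹) * ((n : ℝ) * Real.logb 2 (σ n)) := by
      have hsq : √(n : ℝ) * √n = n := Real.mul_self_sqrt (by linarith)
      have hsq0 : 0 < √(n : ℝ) := Real.sqrt_pos.2 (by linarith)
      rw [add_mul]
      have hA : (√(n : ℝ))⁻¹ * ((n : ℝ) * Real.logb 2 (σ n)) = √n * Real.logb 2 (σ n) := by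
        rw [← mul_assoc]; congr 1
        rw [inv_mul_eq_div, Real.div_sqrt]
      have hB : 2 * (Real.logb 2 (n : ℝ))⁻¹ * ((n : ℝ) * Real.logb 2 (σ n)) =
          n * (2 * Real.logb 2 (σ n) / Real.logb 2 n) := by
        field_simp
      rw [hA, hB]
      have hA0 : 0 ≤ √(n : ℝ) * Real.logb 2 (σ n) := by positivity
      have hB0 : 0 ≤ (n : ℝ) * (2 * Real.logb 2 (σ n) / Real.logb 2 n) := by positivity
      rcases le_total (σ n : ℝ) (√n) with h | h
      · have h1 : ((min (σ n) n : ℕ) : ℝ) ≤ σ n := by exact_mod_cast min_le_left _ _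
        nlinarith
      · have h1 : ((min (σ n) n : ℕ) : ℝ) ≤ n := by exact_mod_cast min_le_right _ _
        have h2 : Real.logb 2 (n : ℝ) ≤ 2 * Real.logb 2 (σ n) := by
          have h3 := Real.logb_le_logb_of_le one_lt_two hsq0 h
          rw [Real.sqrt_eq_rpow, Real.logb_rpow_eq_mul_logb_of_pos (by linarith)] at h3
          linarith
        have h4 : (1 : ℝ) ≤ 2 * Real.logb 2 (σ n) / Real.logb 2 n := by
          rw [le_div_iff₀ (by linarith)]; linarith
        nlinarith
    have hone : (1 : ℝ) ≤ (n : ℝ)⁻¹ * ((n : ℝ) * Real.logb 2 (σ n)) := by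
      rwa [inv_mul_cancel_left₀ (by linarith)]
    have hdiv : (n : ℝ) / Real.logb (σ n) n =
        (Real.logb 2 n)⁻¹ * ((n : ℝ) * Real.logb 2 (σ n)) := by
      rw [hlam]; field_simp
    have hfirst : ((n : ℝ) / Real.logb (σ n) n) *
        (6 + Real.logb 2 (Real.logb (σ n) n + 1) + k n * Real.logb 2 (σ n)) ≤
        (6 * (Real.logb 2 n)⁻¹ + Real.logb 2 (Real.logb 2 n + 1) / Real.logb 2 n +
      k n / Real.logb (σ n) n) * ((n : ℝ) * Real.logb 2 (σ n)) := by
      have h1 : ((n : ℝ) / Real.logb (σ n) n) * Real.logb 2 (Real.logb (σ n) n + 1) ≤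
          (Real.logb 2 (Real.logb 2 n + 1) / Real.logb 2 n) *
            ((n : ℝ) * Real.logb 2 (σ n)) := by
        refine (mul_le_mul_of_nonneg_left hll (by positivity)).trans (le_of_eq ?_)
        rw [hdiv]; ring
      have h2 : ((n : ℝ) / Real.logb (σ n) n) * (k n * Real.logb 2 (σ n)) =
          (k n / Real.logb (σ n) n) * ((n : ℝ) * Real.logb 2 (σ n)) := by ring
      rw [mul_add, mul_add, h2, hdiv, ← hdiv]
      rw [add_mul, add_mul]
      have h3 : ((n : ℝ) / Real.logb (σ n) n) * 6 =
          6 * (Real.logb 2 (n : ℝ))⁻¹ * ((n : ℝ) * Real.logb 2 (σ n)) := by rw [hdiv]; ring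
      linarith
    have hnn : 0 ≤ redundancy (σ n) (k n) n := by
      rw [redundancy]; positivity
    have hle : redundancy (σ n) (k n) n ≤ ε n * ((n : ℝ) * Real.logb 2 (σ n)) := by
      simp only [redundancy, ε]
      rw [add_mul, add_mul, add_mul, mul_assoc 150, mul_assoc 150, mul_assoc 4, ← hdiv]
      linarith
    rw [Real.norm_of_nonneg hnn, Real.norm_of_nonneg (hnn.trans hle)]
    exact hle
  have hε' : ε =o[atTop] fun _ => (1 : ℝ) := (isLittleO_one_iff ℝ).2 hε
  exact hbound.trans_isLittleO
    ((hε'.mul_isBigO (isBigO_refl (fun n : ℕ => (n : ℝ) * Real.logb 2 (σ n)) atTop)).congr_right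
      fun n => one_mul _)

end GrammarCompression

theorem mainTheorem5 (σ k : ℕ → ℕ) (hσ : ∀ n, 2 ≤ σ n)
    (hk : (fun n : ℕ => (k n : ℝ)) =o[atTop] fun n : ℕ => Real.logb (σ n) n) :
    ∃ (C : ℝ) (g : ℕ → ℝ),
      (g =o[atTop] fun n : ℕ => (n : ℝ) * Real.logb 2 (σ n)) ∧
      ∀ (n : ℕ) (Γ : Type*) [Fintype Γ] [DecidableEq Γ] (S : List Γ)
        (G : GrammarCompression.FullGrammar Γ),
        Fintype.card Γ = σ n → S.length = n → G.Generates S → G.Irreducible →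
          G.entropyCodingSize ≤ 2 * (n : ℝ) * GrammarCompression.entropy (k n) S + g n ∧
          (σ n ≤ n → ∀ c : Γ ⊕ Fin G.numNT → List Bool,
            GrammarCompression.IsOptimalPrefixCode c G.concat →
              (G.prefixCodingSize c : ℝ) ≤
                2 * (n : ℝ) * GrammarCompression.entropy (k n) S + g n) ∧
          (2 ≤ n → (G.concat.length : ℝ) ≤ C * ((n : ℝ) / Real.logb (σ n) n)) := by
  -- The redundancy is taken at `max n 2` so that log_σ is positive even for n < 2.
  refine ⟨150, fun n => GrammarCompression.redundancy (σ n) (k n) (max n 2),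
    GrammarCompression.redundancy_isLittleO σ k hσ hk, ?_⟩
  intro n Γ _ _ S G hΓ hn hS hG
  have hΓ2 : 2 ≤ Fintype.card Γ := hΓ ▸ hσ n
  obtain ⟨h1, h2⟩ := hG.size_le hS hΓ2 (le_max_right n 2) (hn.le.trans (le_max_left n 2)) (k n)
  rw [hΓ, hn] at h1 h2
  refine ⟨h1, fun hσn => h2 (hσn.trans (le_max_left n 2)), fun h2n => ?_⟩
  have h3 := hG.length_concat_le hS hΓ2 h2n hn.le
  rwa [hΓ] at h3
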